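/- Conventions. $T$ is a complete first-order theory in an arbitrary language, formulas are first-order formulas over $\emptyset$, and tuples of variables and parameters are finite. A set of formulas with parameters in a model $M$ of $T$ is consistent if each of its finite subsets is realised in $M$. - $T$ has $\mathsf{SOP}_3$ if there are a formula $\varphi(x;y)$ with $|x|=|y|$, a model $M\models T$ and a sequence $(a_i)_{i<\omega}$ of tuples of $M$ such that $M\models\varphi(a_i;a_j)$ for all $i<j$, and $M\models\neg\exists x_0x_1x_2\,(\varphi(x_0;x_1)\wedge\varphi(x_1;x_2)\wedge\varphi(x_2;x_0))$. - A consistency pattern $\mathcal P=(J,\mathcal I,\mathcal C)$ consists of a nonempty set $J$, a nonempty family $\mathcal I$ of two-element subsets of $J$ (the inconsistent pairs) and a nonempty family $\mathcal C$ of subsets of $J$ (the consistent sets), such that there are no $I\in\mathcal I$, $C\in\mathcal C$ with $I\subseteq C$ or $C\subseteq I$. It is maximal if: (M1) every two-element subset of $J$ that is not in $\mathcal I$ is contained in some $C\in\mathcal C$; (M2) for all $C\in\mathcal C$ and $j\in J\setminus C$ there is $i\in C$ with $\{i,j\}\in\mathcal I$; (M3) for every $j\in J$ there are at least two $i\in J$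 with $\{i,j\}\in\mathcal I$. - $T$ has the tree property given by $\mathcal P$ if there are a formula $\varphi(x;y)$, a model $M\models T$ and tuples $(b^j)_{j\in J}$ in $M^{|y|}$ such that $\{\varphi(x;b^j): j\in C\}$ is consistent for every $C\in\mathcal C$, and $\{\varphi(x;b^j): j\in I\}$ is inconsistent for every $I\in\mathcal I$. - $\Sigma_{\mathcal P}$ is the poset with pairwise distinct elements $\beta_j,\gamma_j$ ($j\in J$) and $\alpha_C,\delta_C$ ($C\in\mathcal C$), whose strict order is the transitive closure of the relations $\alpha_C<\beta_i$ and $\gamma_i<\delta_C$ for $i\in C\in\mathcal C$, and $\beta_i<\gamma_j$ for $\{i,j\}\in\mathcal I$. - For a poset $\Sigma$, $T$ has $\mathsf{SOP}_\Sigma$ if there are a formula $\psi(x;y)$ and a model $M\models T$ such that for every finite poset $\sigma$ that embeds in $\Sigma$ there are tuples $(d^s)_{s\in\sigma}$ in $M^{|y|}$ with $M\models\forall x\,(\psi(x;d^{s_0})\to\psi(x;d^{s_1}))$ if and only if $s_0\le s_1$, for all $s_0,s_1\in\sigma$. Statement. Let $\mathcal P=(J,\mathcal I,\mathcal C)$,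 where $J=\mathbb Z\times\{0,1\}$, $\mathcal I=\{\{(i,0),(j,1)\}: i\ge j\}$ and $\mathcal C=\{C_k: k\in\mathbb Z\}$ with $C_k=\{(i,0): i<k\}\cup\{(j,1): j\ge k\}$. Then $\mathcal P$ is a maximal consistency pattern, and for every complete first-order theory $T$: 1. $T$ has $\mathsf{SOP}_3$ if and only if $T$ has the tree property given by $\mathcal P$; 2. $T$ has $\mathsf{SOP}_3$ if and only if $T$ has $\mathsf{SOP}_{\Sigma_{\mathcal P}}$. -/

import Mathlib

universe u v w

namespace DividingLines

open FirstOrder.Language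

/-! ### Formulas with parameters in a model

A partitioned formula `φ(x; y)` with `|x| = m` and `|y| = n` is an element of
`L.Formula (Fin m ⊕ Fin n)`. -/

section Formulas

variable {L : FirstOrder.Language.{u, v}}

/-- `M ⊨ φ(a; b)`. -/
def Holds (M : Type w) [L.Structure M] {m n : ℕ} (φ : L.Formula (Fin m ⊕ Fin n))
    (a : Fin m → M) (b : Fin n → M) : Prop :=
  φ.Realize (Sum.elim a b)

/-- `M ⊨ ∀ x, φ(x; b) → φ(x; c)`. -/
def Implies (M : Type w) [L.Structure M] {m n : ℕ} (φ : L.Formula (Fin m ⊕ Fin n))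
    (b c : Fin n → M) : Prop :=
  ∀ a : Fin m → M, Holds M φ a b → Holds M φ a c

/-- The set of formulas `{φ(x; b j) | j ∈ S}` over `M` is consistent (with the elementary diagram
of `M`), that is, each of its finite subsets is realised in `M`. -/
def Consistent (M : Type w) [L.Structure M] {m n : ℕ} (φ : L.Formula (Fin m ⊕ Fin n))
    {J : Type*} (b : J → Fin n → M) (S : Set J) : Prop :=
  ∀ s : Finset J, (s : Set J) ⊆ S → ∃ a : Fin m → M, ∀ j ∈ s, Holds M φ a (b j)

end Formulas

/-! ### The property `SOP₃` -/

section SOP3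

variable {L : FirstOrder.Language.{u, v}}

/-- The formula `φ(x; y)`, with `|x| = |y| = n`, has `SOP₃` with respect to `T`: in some model of
`T`, it orders some infinite sequence of tuples, and it has no directed cycle of length `3`. -/
def FormulaHasSOP3 (T : L.Theory) {n : ℕ} (φ : L.Formula (Fin n ⊕ Fin n)) : Prop :=
  ∃ M : Theory.ModelType.{u, v, max u v} T,
    (∃ a : ℕ → Fin n → M, ∀ i j, i < j → Holds M φ (a i) (a j)) ∧
    ¬ ∃ x y z : Fin n → M, Holds M φ x y ∧ Holds M φ y z ∧ Holds M φ z x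

/-- `T` has `SOP₃`. -/
def HasSOP3 (T : L.Theory) : Prop :=
  ∃ (n : ℕ) (φ : L.Formula (Fin n ⊕ Fin n)), FormulaHasSOP3 T φ

end SOP3

/-! ### The properties `SOP_𝒦` and `SOP_Σ` -/

section SOPPoset

variable {L : FirstOrder.Language.{u, v}}

/-- The partitioned formula `ψ(x; y)` has `SOP_𝒦`, for a class `𝒦` of finite posets. The same
model is used for all members of `𝒦`. -/
def FormulaHasSOPClass (T : L.Theory) (K : Set FinPartOrd.{0}) {m n : ℕ}
    (ψ : L.Formula (Fin m ⊕ Fin n)) : Prop :=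
  ∃ M : Theory.ModelType.{u, v, max u v} T, ∀ σ ∈ K, ∃ d : σ → Fin n → M,
    ∀ s₀ s₁ : σ, Implies M ψ (d s₀) (d s₁) ↔ s₀ ≤ s₁

/-- `T` has `SOP_𝒦`. -/
def HasSOPClass (T : L.Theory) (K : Set FinPartOrd.{0}) : Prop :=
  ∃ (m n : ℕ) (ψ : L.Formula (Fin m ⊕ Fin n)), FormulaHasSOPClass T K ψ

/-- The age of a poset `P`: the class of finite posets that embed in `P`. -/
def age (P : Type w) [PartialOrder P] : Set FinPartOrd.{0} :=
  {σ | Nonempty (σ ↪o P)}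

/-- `T` has `SOP_P`, for an arbitrary poset `P`. -/
def HasSOPPoset (T : L.Theory) (P : Type w) [PartialOrder P] : Prop :=
  HasSOPClass T (age P)

end SOPPoset

/-! ### Consistency patterns and tree properties -/

/-- The data of a pattern on an index set `J`: a family of "inconsistent pairs" and a family of
"consistent sets". -/
structure Pattern (J : Type w) where
  /-- the inconsistent pairs -/
  inc : Set (Set J)
  /-- the consistent sets -/
  cons : Set (Set J)

namespace Pattern

variable {J : Type w}

/-- The triple `(J, inc, cons)` is a consistency pattern. -/
structure IsConsistencyPattern (P : Pattern J) : Prop where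
  card_inc : ∀ I ∈ P.inc, I.ncard = 2
  nonempty_index : Nonempty J
  nonempty_inc : P.inc.Nonempty
  nonempty_cons : P.cons.Nonempty
  not_subset : ∀ I ∈ P.inc, ∀ C ∈ P.cons, ¬ I ⊆ C ∧ ¬ C ⊆ I

/-- The triple `(J, inc, cons)` is a maximal consistency pattern. -/
structure IsMaximal (P : Pattern J) : Prop extends IsConsistencyPattern P where
  /-- every pair is either inconsistent or contained in a consistent set -/
  pairs_decided : ∀ i j : J, i ≠ j → ({i, j} : Set J) ∉ P.inc →
    ∃ C ∈ P.cons, ({i, j} : Set J) ⊆ C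
  /-- consistent sets are maximal -/
  cons_maximal : ∀ C ∈ P.cons, ∀ j, j ∉ C → ∃ i ∈ C, ({i, j} : Set J) ∈ P.inc
  /-- every index is inconsistent with at least two indices -/
  two_inconsistent : ∀ j : J, ∃ i₁ i₂ : J, i₁ ≠ i₂ ∧
    ({i₁, j} : Set J) ∈ P.inc ∧ ({i₂, j} : Set J) ∈ P.inc

/-- The elements of the poset associated with a pattern: points `β_j`, `γ_j` for each index `j`,
and points `α_C`, `δ_C` for each consistent set `C`. -/
inductive Sig (P : Pattern J) : Type w
  | alpha (C : P.cons) : Sig P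
  | beta (j : J) : Sig P
  | gamma (j : J) : Sig P
  | delta (C : P.cons) : Sig P

/-- The generating relations of the strict order on `P.Sig`. The constructor `beta_gamma` applies
to both `(i, j)` and `(j, i)`, as `{i, j} = {j, i}`. -/
inductive SigRel (P : Pattern J) : P.Sig → P.Sig → Prop
  | alpha_beta (C : P.cons) (i : J) (h : i ∈ C.1) : SigRel P (.alpha C) (.beta i)
  | gamma_delta (C : P.cons) (i : J) (h : i ∈ C.1) : SigRel P (.gamma i) (.delta C)
  | beta_gamma (i j : J) (h : ({i, j} : Set J) ∈ P.inc) : SigRel P (.beta i) (.gamma j)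

/-- The level of a point; it is only used to see that there are no cycles. -/
def Sig.level {P : Pattern J} : P.Sig → ℕ
  | .alpha _ => 0
  | .beta _ => 1
  | .gamma _ => 2
  | .delta _ => 3

theorem level_lt_of_transGen {P : Pattern J} {s t : P.Sig}
    (h : Relation.TransGen P.SigRel s t) : s.level < t.level := by
  have key : ∀ {a b : P.Sig}, P.SigRel a b → a.level < b.level := by
    intro a b hab
    cases hab <;> simp [Sig.level]
  induction h with
  | single h => exact key h
  | tail _ h ih => exact ih.trans (key h)

/-- The poset associated with a pattern: its strict order is the transitive closure of the
generating relations. -/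
instance (P : Pattern J) : PartialOrder P.Sig where
  le s t := s = t ∨ Relation.TransGen P.SigRel s t
  lt s t := Relation.TransGen P.SigRel s t
  le_refl s := Or.inl rfl
  le_trans := by
    rintro a b c (rfl | h) (rfl | h')
    · exact Or.inl rfl
    · exact Or.inr h'
    · exact Or.inr h
    · exact Or.inr (h.trans h')
  lt_iff_le_not_ge := by
    intro a b
    constructor
    · intro h
      have hl := level_lt_of_transGen h
      refine ⟨Or.inr h, ?_⟩
      rintro (rfl | h')
      · exact lt_irrefl _ hl
      · exact lt_asymm hl (level_lt_of_transGen h')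
    · rintro ⟨rfl | h, h'⟩
      · exact absurd (Or.inl rfl) h'
      · exact h
  le_antisymm := by
    rintro a b (rfl | h) (h' | h')
    · rfl
    · rfl
    · exact h'.symm
    · exact absurd (level_lt_of_transGen h') (lt_asymm (level_lt_of_transGen h))

end Pattern

section TreeProperty

variable {L : FirstOrder.Language.{u, v}} {J : Type w}

/-- The partitioned formula `φ(x; y)` has the tree property defined by the pattern `P`. -/
def FormulaHasTreeProperty (T : L.Theory) (P : Pattern J) {m n : ℕ}
    (φ : L.Formula (Fin m ⊕ Fin n)) : Prop :=
  ∃ (M : Theory.ModelType.{u, v, max u v w} T) (b : J → Fin n → M),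
    (∀ C ∈ P.cons, Consistent M φ b C) ∧ (∀ I ∈ P.inc, ¬ Consistent M φ b I)

/-- `T` has the tree property defined by the pattern `P`. -/
def HasTreeProperty (T : L.Theory) (P : Pattern J) : Prop :=
  ∃ (m n : ℕ) (φ : L.Formula (Fin m ⊕ Fin n)), FormulaHasTreeProperty T P φ

end TreeProperty

/-! ### The pattern on `ℤ × {0, 1}` -/

/-- The set `C_k = {(i, 0) | i < k} ∪ {(j, 1) | j ≥ k}`. -/
def sop3Cons (k : ℤ) : Set (ℤ × Fin 2) :=
  {p | ∃ i : ℤ, i < k ∧ p = (i, 0)} ∪ {p | ∃ j : ℤ, j ≥ k ∧ p = (j, 1)}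

/-- The pattern on `ℤ × {0, 1}` whose inconsistent pairs are the `{(i, 0), (j, 1)}` with `i ≥ j`
and whose consistent sets are the `C_k`, for `k ∈ ℤ`. -/
def sop3Pattern : Pattern (ℤ × Fin 2) where
  inc := {I | ∃ i j : ℤ, i ≥ j ∧ I = {(i, 0), (j, 1)}}
  cons := {C | ∃ k : ℤ, C = sop3Cons k}

end DividingLines

/-!
The equivalences go through half graphs of formulas: parameters `b^(i,0)`, `b^(j,1)` such that
`φ(x; b^(i,0))` and `φ(x; b^(j,1))` are inconsistent for `i ≥ j`, while
`{φ(x; b^(i,0)) | i < k} ∪ {φ(x; b^(j,1)) | j ≥ k}` is realised by some `c_k`.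

*From half graphs to `SOP₃`* (`hasSOP3_of_half_graphs`). Relate `(x, y, z)` to `(x', y', z')` if
`φ(x; z')` and `φ(x'; y)` hold and `φ(-; y')`, `φ(-; z)` are inconsistent. The triples
`(c_i, b^(i,0), b^(i,1))` form a chain, and there is no cycle of length `3`: the first components
of a cycle would realise pairs of formulas that its edges declare inconsistent. Finite half graphs
suffice, since arbitrarily long finite chains in one model give an infinite chain in an ultrapower
(`exists_chain_of_long_chains`). The tree property provides finite half graphs by definition. So
does `SOP_Σ`, for the formula `ψ(x; β) ∧ ¬ ψ(x; γ)`: the relation `β_i ≤ γ_j` gives the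
inconsistencies, and a point of `α_C` outside `δ_C`, which exists as `α_C ≰ δ_C`, gives the
consistency along `C`.

*From `SOP₃` to half graphs.* Over a dense chain `(a_p)` a formula `φ` without cycles of length `3`
satisfies `φ(a_p; a_q) ↔ p < q` (`HasSOP3.exists_dense_chain`), and an "interval"
`φ(a_p; x) ∧ φ(x; a_q)` is empty if `q < p`. Sending `(i, 0)` to a final segment and `(j, 1)` to
an initial segment of a copy of `ℤ` in the chain, with overlap exactly when `i < j`, gives the tree
property. For `SOP_Σ`, each of these intervals receives a point of its own, which makes them
pairwise incomparable; then `β_j` is represented by the interval, `γ_j` by its complement, `α_C`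
by the point realising `C`, and `δ_C` by the complement of that point. That inclusion of these sets
is exactly the order of the poset holds for every maximal pattern
(`Pattern.IsMaximal.toSet_subset_iff`).
-/

open FirstOrder FirstOrder.Language

namespace DividingLines

/-! ### The pattern is maximal -/

section ThePattern

theorem pair_mem_inc {p q : ℤ × Fin 2} : ({p, q} : Set (ℤ × Fin 2)) ∈ sop3Pattern.inc ↔
    ∃ i j : ℤ, j ≤ i ∧ (p = (i, 0) ∧ q = (j, 1) ∨ p = (j, 1) ∧ q = (i, 0)) := by
  simp only [sop3Pattern, Set.mem_ofPred_eq, Set.pair_eq_pair_iff, ge_iff_le]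

@[simp]
theorem zero_mem_sop3Cons {i k : ℤ} : ((i, 0) : ℤ × Fin 2) ∈ sop3Cons k ↔ i < k := by
  simp [sop3Cons]

@[simp]
theorem one_mem_sop3Cons {i k : ℤ} : ((i, 1) : ℤ × Fin 2) ∈ sop3Cons k ↔ k ≤ i := by
  simp [sop3Cons]

theorem sop3Cons_mem_cons (k : ℤ) : sop3Cons k ∈ sop3Pattern.cons := ⟨k, rfl⟩

theorem sop3Pattern_isMaximal : sop3Pattern.IsMaximal where
  card_inc := by
    rintro _ ⟨i, j, -, rfl⟩
    exact Set.ncard_pair (by simp)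
  nonempty_index := inferInstance
  nonempty_inc := ⟨_, 0, 0, le_rfl, rfl⟩
  nonempty_cons := ⟨_, 0, rfl⟩
  not_subset := by
    rintro _ ⟨i, j, hij, rfl⟩ _ ⟨k, rfl⟩
    constructor
    · intro h
      have h₀ := zero_mem_sop3Cons.1 (h (Set.mem_insert _ _))
      have h₁ := one_mem_sop3Cons.1 (h (Set.mem_insert_of_mem _ rfl))
      omega
    · intro h
      -- a consistent set contains points `(l, 0)` with `l` arbitrarily small
      have := h (zero_mem_sop3Cons.2 (show min (k - 1) (i - 1) < k by omega))
      simp only [Set.mem_insert_iff, Set.mem_singleton_iff, Prod.mk.injEq] at this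
      rcases this with h | h
      · omega
      · exact absurd h.2 (by decide)
  pairs_decided := by
    rintro ⟨i, e⟩ ⟨j, f⟩ - h
    rw [pair_mem_inc] at h
    have key : ∀ k, (i, e) ∈ sop3Cons k → (j, f) ∈ sop3Cons k →
        ∃ C ∈ sop3Pattern.cons, ({(i, e), (j, f)} : Set (ℤ × Fin 2)) ⊆ C := fun k h₁ h₂ =>
      ⟨_, sop3Cons_mem_cons k, Set.insert_subset h₁ (Set.singleton_subset_iff.2 h₂)⟩
    fin_cases e <;> fin_cases f
    · exact key (max i j + 1) (zero_mem_sop3Cons.2 (by omega)) (zero_mem_sop3Cons.2 (by omega))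
    · refine key j (zero_mem_sop3Cons.2 ?_) (one_mem_sop3Cons.2 le_rfl)
      by_contra hij
      exact h ⟨i, j, by omega, Or.inl ⟨rfl, rfl⟩⟩
    · refine key i (one_mem_sop3Cons.2 le_rfl) (zero_mem_sop3Cons.2 ?_)
      by_contra hij
      exact h ⟨j, i, by omega, Or.inr ⟨rfl, rfl⟩⟩
    · exact key (min i j) (one_mem_sop3Cons.2 (by omega)) (one_mem_sop3Cons.2 (by omega))
  cons_maximal := by
    rintro _ ⟨k, rfl⟩ ⟨j, f⟩ hj
    fin_cases f
    · exact ⟨(k, 1), one_mem_sop3Cons.2 le_rfl, pair_mem_inc.2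
        ⟨j, k, not_lt.1 fun h => hj (zero_mem_sop3Cons.2 h), Or.inr ⟨rfl, rfl⟩⟩⟩
    · refine ⟨(k - 1, 0), zero_mem_sop3Cons.2 (by omega), pair_mem_inc.2
        ⟨k - 1, j, ?_, Or.inl ⟨rfl, rfl⟩⟩⟩
      have : ¬ k ≤ j := fun h => hj (one_mem_sop3Cons.2 h)
      omega
  two_inconsistent := by
    rintro ⟨j, f⟩
    fin_cases f
    · exact ⟨(j, 1), (j - 1, 1), fun h => by have := (Prod.ext_iff.1 h).1; omega,
        pair_mem_inc.2 ⟨j, j, le_rfl, Or.inr ⟨rfl, rfl⟩⟩,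
        pair_mem_inc.2 ⟨j, j - 1, by omega, Or.inr ⟨rfl, rfl⟩⟩⟩
    · exact ⟨(j, 0), (j + 1, 0), by simp, pair_mem_inc.2 ⟨j, j, le_rfl, Or.inl ⟨rfl, rfl⟩⟩,
        pair_mem_inc.2 ⟨j + 1, j, by omega, Or.inl ⟨rfl, rfl⟩⟩⟩

end ThePattern

/-! ### Representing the poset of a pattern by sets -/

section Representation

variable {J X : Type*} {P : Pattern J}

namespace Pattern

/-- The set attached to a point of the poset of a pattern, given sets `B j` and points `c C`:
`β_j` is sent to `B j`, `γ_j` to its complement, `α_C` to `{c C}` and `δ_C` to its complement. -/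
def Sig.toSet (B : J → Set X) (c : P.cons → X) : P.Sig → Set X
  | .alpha C => {c C}
  | .beta j => B j
  | .gamma j => (B j)ᶜ
  | .delta C => {c C}ᶜ

theorem Sig.lt_of_rel {s t : P.Sig} (h : P.SigRel s t) : s < t := Relation.TransGen.single h

theorem Sig.beta_le_gamma {i j : J} (h : ({i, j} : Set J) ∈ P.inc) :
    (.beta i : P.Sig) ≤ .gamma j := (Sig.lt_of_rel (.beta_gamma i j h)).le

theorem Sig.alpha_le_beta {C : P.cons} {i : J} (h : i ∈ C.1) : (.alpha C : P.Sig) ≤ .beta i :=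
  (Sig.lt_of_rel (.alpha_beta C i h)).le

theorem Sig.gamma_le_delta {C : P.cons} {i : J} (h : i ∈ C.1) : (.gamma i : P.Sig) ≤ .delta C :=
  (Sig.lt_of_rel (.gamma_delta C i h)).le

theorem IsMaximal.alpha_le_delta_of_ne (hP : P.IsMaximal) {C D : P.cons} (h : C ≠ D) :
    (.alpha C : P.Sig) ≤ .delta D := by
  have key : ∃ i ∈ C.1, ∃ j ∈ D.1, ({i, j} : Set J) ∈ P.inc := by
    by_cases hDC : D.1 ⊆ C.1
    · have hCD : ¬ C.1 ⊆ D.1 := fun hCD => h (Subtype.ext (hCD.antisymm hDC))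
      obtain ⟨i, hiC, hiD⟩ := Set.not_subset.1 hCD
      obtain ⟨j, hj, hji⟩ := hP.cons_maximal D.1 D.2 i hiD
      exact ⟨i, hiC, j, hj, by rwa [Set.pair_comm]⟩
    · obtain ⟨j, hjD, hjC⟩ := Set.not_subset.1 hDC
      obtain ⟨i, hi, hij⟩ := hP.cons_maximal C.1 C.2 j hjC
      exact ⟨i, hi, j, hjD, hij⟩
  obtain ⟨i, hi, j, hj, hij⟩ := key
  exact (Sig.alpha_le_beta hi).trans ((Sig.beta_le_gamma hij).trans (Sig.gamma_le_delta hj))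

/-- In `P.Sig` the points `α_C` and `δ_C` are incomparable, as a consistent set contains no
inconsistent pair. -/
theorem IsConsistencyPattern.not_alpha_le_delta (hP : P.IsConsistencyPattern) (C : P.cons) :
    ¬ (.alpha C : P.Sig) ≤ .delta C := by
  -- the sets of points that can lie above `α_C`
  have key : ∀ t : P.Sig, Relation.TransGen P.SigRel (.alpha C) t →
      (∃ i ∈ C.1, t = .beta i) ∨
      (∃ i ∈ C.1, ∃ j, ({i, j} : Set J) ∈ P.inc ∧ t = .gamma j) ∨
      (∃ i ∈ C.1, ∃ j, ({i, j} : Set J) ∈ P.inc ∧ ∃ D : P.cons, j ∈ D.1 ∧ t = .delta D) := by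
    intro t h
    induction h with
    | single h => cases h with | alpha_beta _ i hi => exact Or.inl ⟨i, hi, rfl⟩
    | tail _ h ih =>
      rcases ih with ⟨i, hi, rfl⟩ | ⟨i, hi, j, hij, rfl⟩ | ⟨i, hi, j, hij, D, hj, rfl⟩
      · cases h with | beta_gamma _ j hij => exact Or.inr (Or.inl ⟨i, hi, j, hij, rfl⟩)
      · cases h with
        | gamma_delta D _ hj => exact Or.inr (Or.inr ⟨i, hi, j, hij, D, hj, rfl⟩)
      · cases h
  rintro (h | h)
  · cases h
  · rcases key _ h with ⟨i, hi, h⟩ | ⟨i, hi, j, hij, h⟩ | ⟨i, hi, j, hij, D, hj, h⟩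
    · cases h
    · cases h
    · cases h
      exact (hP.not_subset _ hij C.1 C.2).1
        (Set.insert_subset hi (Set.singleton_subset_iff.2 hj))

/-- The sets `Sig.toSet B c` represent the order of `P.Sig` as soon as `c C` lies in exactly the
`B i` with `i ∈ C`, inconsistent indices have disjoint sets, every `B i` has a private point `p i`,
and some point `q` is in none of the `B i`. The private points keep the `B i` pairwise
incomparable. -/
theorem IsMaximal.toSet_subset_iff (hP : P.IsMaximal) {B : J → Set X} {c : P.cons → X}
    {p : J → X} {q : X} (hc : ∀ C i, c C ∈ B i ↔ i ∈ C.1)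
    (hdisj : ∀ i j, ({i, j} : Set J) ∈ P.inc → Disjoint (B i) (B j))
    (hp : ∀ i j, p i ∈ B j ↔ i = j) (hpc : ∀ i C, p i ≠ c C)
    (hqB : ∀ i, q ∉ B i) (hqc : ∀ C, q ≠ c C) (s t : P.Sig) :
    Sig.toSet B c s ⊆ Sig.toSet B c t ↔ s ≤ t := by
  have hcinj : ∀ C D, c C = c D → C = D := fun C D h =>
    Subtype.ext (Set.ext fun i => by rw [← hc, ← hc, h])
  constructor
  · intro h
    cases s with
    | alpha C =>
      have h : c C ∈ Sig.toSet B c t := h rfl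
      cases t with
      | alpha D => rw [hcinj C D h]
      | beta i => exact Sig.alpha_le_beta ((hc C i).1 h)
      | gamma j =>
        obtain ⟨i, hi, hij⟩ := hP.cons_maximal C.1 C.2 j fun hj => h ((hc C j).2 hj)
        exact (Sig.alpha_le_beta hi).trans (Sig.beta_le_gamma hij)
      | delta D => exact hP.alpha_le_delta_of_ne fun hCD => h (congrArg c hCD)
    | beta i =>
      cases t with
      | alpha D => exact absurd (h ((hp i i).2 rfl)) (hpc i D)
      | beta j => rw [(hp i j).1 (h ((hp i i).2 rfl))]
      | gamma j =>
        refine Sig.beta_le_gamma (by_contra fun hij => ?_)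
        have hne : i ≠ j := fun e => h ((hp i i).2 rfl) ((hp i j).2 e)
        obtain ⟨C, hC, hsub⟩ := hP.pairs_decided i j hne hij
        exact h ((hc ⟨C, hC⟩ i).2 (hsub (by simp))) ((hc ⟨C, hC⟩ j).2 (hsub (by simp)))
      | delta D =>
        obtain ⟨j, hj, hji⟩ := hP.cons_maximal D.1 D.2 i fun hi => h ((hc D i).2 hi) rfl
        exact (Sig.beta_le_gamma (by rwa [Set.pair_comm])).trans (Sig.gamma_le_delta hj)
    | gamma i =>
      cases t with
      | alpha D => exact absurd (h (hqB i)) (hqc D)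
      | beta j => exact absurd (h (hqB i)) (hqB j)
      | gamma j =>
        by_contra hij
        refine h (a := p j) (fun hji => hij ?_) ((hp j j).2 rfl)
        rw [(hp j i).1 hji]
      | delta D =>
        exact Sig.gamma_le_delta ((hc D i).1 (by_contra fun hi => h hi rfl))
    | delta C =>
      cases t with
      | alpha D => exact absurd (h (hqc C)) (hqc D)
      | beta j => exact absurd (h (hqc C)) (hqB j)
      | gamma j => exact absurd ((hp j j).2 rfl) (h (hpc j C))
      | delta D =>
        by_contra hCD
        exact h (a := c D) (fun e => hCD (by rw [hcinj D C e])) rfl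
  · have key : ∀ {s t : P.Sig}, P.SigRel s t → Sig.toSet B c s ⊆ Sig.toSet B c t := by
      intro s t h
      cases h with
      | alpha_beta C i hi => exact Set.singleton_subset_iff.2 ((hc C i).2 hi)
      | gamma_delta C i hi =>
        exact Set.compl_subset_compl.2 (Set.singleton_subset_iff.2 ((hc C i).2 hi))
      | beta_gamma i j hij => exact (hdisj i j hij).subset_compl_right
    rintro (rfl | h)
    · exact subset_rfl
    · induction h with
      | single h => exact key h
      | tail _ h ih => exact ih.trans (key h)

end Pattern

end Representation

/-! ### Chains in ultrapowers -/

section Ultrapower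

variable {L : FirstOrder.Language.{u, v}} {T : L.Theory}

/-- Łoś's theorem for a partitioned formula in an ultrapower. -/
theorem holds_ultrapower {α : Type*} {M : Type w} [L.Structure M] [Nonempty M] (U : Ultrafilter α)
    {m n : ℕ} (φ : L.Formula (Fin m ⊕ Fin n)) (x : Fin m → α → M) (y : Fin n → α → M) :
    Holds ((U : Filter α).Product fun _ => M) φ
        (fun i => (x i : (U : Filter α).Product fun _ => M))
        (fun i => (y i : (U : Filter α).Product fun _ => M)) ↔
      ∀ᶠ k in U, Holds M φ (fun i => x i k) (fun i => y i k) := by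
  have h := Ultraproduct.realize_formula_cast (M := fun _ : α => M) (u := U) φ (Sum.elim x y)
  have h₂ (k : α) : (fun i => Sum.elim x y i k) = Sum.elim (fun i => x i k) (fun i => y i k) :=
    funext fun i => by cases i <;> rfl
  simp only [h₂] at h
  refine Iff.trans (iff_of_eq (congrArg φ.Realize (funext fun i => ?_))) h
  cases i <;> rfl

/-- For each `k`, a map from a countable linear order to `{0, …, k}`: it counts those of the first
`k` elements of an enumeration that are below the given element. -/
theorem exists_eventually_strictMono (I : Type*) [LinearOrder I] [Countable I] :
    ∃ f : ℕ → I → ℕ, (∀ k i, f k i ≤ k) ∧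
      ∀ i j, i < j → ∀ᶠ k in Filter.atTop, f k i < f k j := by
  classical
  obtain ⟨g, hg⟩ := exists_injective_nat I
  refine ⟨fun k i => ((Finset.range k).filter fun m => ∃ l, g l = m ∧ l < i).card, fun k i => ?_,
    fun i j hij => ?_⟩
  · exact (Finset.card_filter_le _ _).trans (Finset.card_range k).le
  · filter_upwards [Filter.eventually_gt_atTop (g i)] with k hk
    refine Finset.card_lt_card (Finset.ssubset_iff_of_subset ?_ |>.2 ⟨g i, ?_, ?_⟩)
    · exact Finset.monotone_filter_right _ fun m _ ⟨l, hl, hli⟩ => ⟨l, hl, hli.trans hij⟩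
    · exact Finset.mem_filter.2 ⟨Finset.mem_range.2 hk, i, rfl, hij⟩
    · rintro h
      obtain ⟨l, hl, hli⟩ := (Finset.mem_filter.1 h).2
      exact hli.ne (hg hl)

/-- A formula without directed cycles of length `3` that has arbitrarily long finite chains in `M`
orders a sequence of any countable order type in an ultrapower of `M`, still without such cycles. -/
theorem exists_chain_of_long_chains (M : Theory.ModelType.{u, v, max u v} T) {n : ℕ}
    (φ : L.Formula (Fin n ⊕ Fin n))
    (hlong : ∀ N : ℕ, ∃ a : ℕ → Fin n → M, ∀ i j, i < j → j ≤ N → Holds M φ (a i) (a j))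
    (hcyc : ∀ x y z : Fin n → M, Holds M φ x y → Holds M φ y z → ¬ Holds M φ z x)
    (I : Type) [LinearOrder I] [Countable I] :
    ∃ N : Theory.ModelType.{u, v, max u v} T,
      (∃ a : I → Fin n → N, ∀ i j, i < j → Holds N φ (a i) (a j)) ∧
      ∀ x y z : Fin n → N, Holds N φ x y → Holds N φ y z → ¬ Holds N φ z x := by
  let U : Ultrafilter ℕ := Filter.hyperfilter ℕ
  let N := (U : Filter ℕ).Product fun _ => (M : Type (max u v))
  have hN : N ⊨ T := Theory.model_iff T |>.2 fun σ hσ =>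
    (Ultraproduct.sentence_realize (M := fun _ : ℕ => (M : Type (max u v))) (u := U) σ).2
      (Filter.Eventually.of_forall fun _ => Theory.realize_sentence_of_mem T hσ)
  have : Nonempty N := Ultraproduct.Product.instNonempty
  refine ⟨Theory.ModelType.of T N, ?_, ?_⟩
  · choose a ha using hlong
    obtain ⟨f, hf, hmono⟩ := exists_eventually_strictMono I
    refine ⟨fun i l => ((fun k => a k (f k i) l : ℕ → M) : N), fun i j hij => ?_⟩
    refine (holds_ultrapower U φ _ _).2 ?_
    filter_upwards [Nat.hyperfilter_le_atTop (hmono i j hij)] with k hk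
    exact ha k _ _ hk (hf k j)
  · intro x y z
    obtain ⟨x, rfl⟩ : ∃ x' : Fin n → ℕ → M, (fun i => (x' i : N)) = x :=
      ⟨fun i => (x i).out, funext fun i => Quotient.out_eq _⟩
    obtain ⟨y, rfl⟩ : ∃ x' : Fin n → ℕ → M, (fun i => (x' i : N)) = y :=
      ⟨fun i => (y i).out, funext fun i => Quotient.out_eq _⟩
    obtain ⟨z, rfl⟩ : ∃ x' : Fin n → ℕ → M, (fun i => (x' i : N)) = z :=
      ⟨fun i => (z i).out, funext fun i => Quotient.out_eq _⟩
    intro hxy hyz hzx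
    obtain ⟨k, h₁, h₂, h₃⟩ := (((holds_ultrapower U φ x y).1 hxy).and
      (((holds_ultrapower U φ y z).1 hyz).and ((holds_ultrapower U φ z x).1 hzx))).exists
    exact hcyc _ _ _ h₁ h₂ h₃

end Ultrapower

/-! ### From half graphs of formulas to `SOP₃` -/

section HalfGraph

variable {L : FirstOrder.Language.{u, v}} {T : L.Theory}

/-- A formula in arbitrary finite tuples of variables, as a formula in `Fin`-indexed tuples. -/
noncomputable def reindex {ι κ : Type} [Finite ι] [Finite κ] (φ : L.Formula (ι ⊕ κ)) :
    L.Formula (Fin (Nat.card ι) ⊕ Fin (Nat.card κ)) :=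
  φ.relabel (Sum.map (Finite.equivFin ι) (Finite.equivFin κ))

theorem holds_reindex {ι κ : Type} [Finite ι] [Finite κ] (φ : L.Formula (ι ⊕ κ)) {M : Type w}
    [L.Structure M] (a : Fin (Nat.card ι) → M) (b : Fin (Nat.card κ) → M) :
    Holds M (reindex φ) a b ↔
      φ.Realize (Sum.elim (a ∘ Finite.equivFin ι) (b ∘ Finite.equivFin κ)) := by
  rw [Holds, reindex, Formula.realize_relabel, Sum.elim_comp_map]

theorem holds_reindex_comp {ι κ : Type} [Finite ι] [Finite κ] (φ : L.Formula (ι ⊕ κ)) {M : Type w}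
    [L.Structure M] (a : ι → M) (b : κ → M) :
    Holds M (reindex φ) (a ∘ (Finite.equivFin ι).symm) (b ∘ (Finite.equivFin κ).symm) ↔
      φ.Realize (Sum.elim a b) := by
  rw [holds_reindex]
  simp [Function.comp_assoc]

theorem hasSOP3_of_long_chains (M : Theory.ModelType.{u, v, max u v} T) {κ : Type} [Finite κ]
    (φ : L.Formula (κ ⊕ κ))
    (hlong : ∀ N : ℕ, ∃ a : ℕ → κ → M, ∀ i j, i < j → j ≤ N → φ.Realize (Sum.elim (a i) (a j)))
    (hcyc : ∀ x y z : κ → M, φ.Realize (Sum.elim x y) → φ.Realize (Sum.elim y z) →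
      ¬ φ.Realize (Sum.elim z x)) : HasSOP3 T := by
  obtain ⟨N, ha, hN⟩ := exists_chain_of_long_chains M (reindex φ)
    (fun N => by
      obtain ⟨a, ha⟩ := hlong N
      exact ⟨fun i => a i ∘ (Finite.equivFin κ).symm, fun i j hij hj =>
        (holds_reindex_comp φ _ _).2 (ha i j hij hj)⟩)
    (fun x y z => by
      simp only [holds_reindex]
      exact hcyc _ _ _) ℕ
  exact ⟨_, reindex φ, N, ha, fun ⟨x, y, z, h₁, h₂, h₃⟩ => hN x y z h₁ h₂ h₃⟩

/-- The formula `φ(x; z') ∧ φ(x'; y) ∧ ¬ ∃ w, φ(w; y') ∧ φ(w; z)` in the variables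
`(x, y, z; x', y', z')`. In a directed cycle of three tuples `(xᵢ, yᵢ, zᵢ)`, the element `x₀` would
satisfy `φ(x; z₁)` and `φ(x; y₂)`, which the edge from `1` to `2` forbids. -/
noncomputable def crossFormula {ι κ : Type} [Finite ι] (φ : L.Formula (ι ⊕ κ)) :
    L.Formula ((ι ⊕ κ ⊕ κ) ⊕ (ι ⊕ κ ⊕ κ)) :=
  φ.relabel (Sum.elim (fun i => .inl (.inl i)) (fun k => .inr (.inr (.inr k)))) ⊓
  φ.relabel (Sum.elim (fun i => .inr (.inl i)) (fun k => .inl (.inr (.inl k)))) ⊓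
  (Formula.iExs ι
    (φ.relabel (Sum.elim (fun i => .inr i) (fun k => .inl (.inr (.inr (.inl k))))) ⊓
     φ.relabel (Sum.elim (fun i => .inr i) (fun k => .inl (.inl (.inr (.inr k))))))).not

theorem realize_crossFormula {ι κ : Type} [Finite ι] (φ : L.Formula (ι ⊕ κ)) {M : Type w}
    [L.Structure M] (e e' : ι ⊕ κ ⊕ κ → M) :
    (crossFormula φ).Realize (Sum.elim e e') ↔
      (φ.Realize (Sum.elim (e ∘ .inl) (e' ∘ .inr ∘ .inr)) ∧
       φ.Realize (Sum.elim (e' ∘ .inl) (e ∘ .inr ∘ .inl))) ∧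
      ¬ ∃ x : ι → M, φ.Realize (Sum.elim x (e' ∘ .inr ∘ .inl)) ∧
        φ.Realize (Sum.elim x (e ∘ .inr ∘ .inr)) := by
  simp only [crossFormula, Formula.realize_inf, Formula.realize_not, Formula.realize_iExs,
    Formula.realize_relabel, Sum.comp_elim]
  rfl

/-- If for every `N` there are parameters `y₀, …, y_N` and `z₀, …, z_N` such that `φ(x; yᵢ)` and
`φ(x; zⱼ)` are inconsistent for `j ≤ i`, while each of the sets
`{φ(x; yᵢ) | i < k} ∪ {φ(x; zⱼ) | k ≤ j}` is realised, then `T` has `SOP₃`. -/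
theorem hasSOP3_of_half_graphs (M : Theory.ModelType.{u, v, max u v} T) {ι κ : Type} [Finite ι]
    [Finite κ] (φ : L.Formula (ι ⊕ κ))
    (h : ∀ N : ℕ, ∃ (y z : ℕ → κ → M) (c : ℕ → ι → M),
      (∀ i k, i < k → k ≤ N → φ.Realize (Sum.elim (c k) (y i))) ∧
      (∀ k j, k ≤ j → j ≤ N → φ.Realize (Sum.elim (c k) (z j))) ∧
      ∀ i j, j ≤ i → i ≤ N → ∀ x : ι → M, φ.Realize (Sum.elim x (y i)) →
        ¬ φ.Realize (Sum.elim x (z j))) : HasSOP3 T := by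
  refine hasSOP3_of_long_chains M (crossFormula φ) (fun N => ?_) fun e₀ e₁ e₂ => ?_
  · obtain ⟨y, z, c, h₁, h₂, h₃⟩ := h N
    refine ⟨fun i => Sum.elim (c i) (Sum.elim (y i) (z i)), fun i j hij hj => ?_⟩
    exact (realize_crossFormula φ _ _).2 ⟨⟨h₂ i j hij.le hj, h₁ i j hij hj⟩,
      fun ⟨x, hx, hx'⟩ => h₃ j i hij.le hj x hx hx'⟩
  · simp only [realize_crossFormula]
    exact fun h₀₁ h₁₂ h₂₀ => h₁₂.2 ⟨_, h₂₀.1.2, h₀₁.1.1⟩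

theorem hasSOP3_of_hasTreeProperty (h : HasTreeProperty T sop3Pattern) : HasSOP3 T := by
  obtain ⟨m, n, φ, M, b, hC, hI⟩ := h
  refine hasSOP3_of_half_graphs M φ fun N => ?_
  have hc : ∀ k : ℕ, ∃ c : Fin m → M, ∀ i ≤ N, (i < k → Holds M φ c (b (i, 0))) ∧
      (k ≤ i → Holds M φ c (b (i, 1))) := by
    classical
    intro k
    let s : Finset (ℤ × Fin 2) := (Finset.range (N + 1)).image fun i : ℕ =>
      if i < k then ((i : ℤ), 0) else ((i : ℤ), 1)
    obtain ⟨c, hc⟩ := hC _ (sop3Cons_mem_cons k) s (by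
      intro p hp
      obtain ⟨i, -, rfl⟩ := Finset.mem_image.1 (Finset.mem_coe.1 hp)
      split_ifs with hik
      · exact zero_mem_sop3Cons.2 (by omega)
      · exact one_mem_sop3Cons.2 (by omega))
    refine ⟨c, fun i hi => ⟨fun hik => hc _ ?_, fun hik => hc _ ?_⟩⟩
    · exact Finset.mem_image.2 ⟨i, Finset.mem_range.2 (by omega), if_pos hik⟩
    · exact Finset.mem_image.2 ⟨i, Finset.mem_range.2 (by omega), if_neg (by omega)⟩
  choose c hc using hc
  refine ⟨fun i => b (i, 0), fun j => b (j, 1), c, fun i k hik hk => (hc k i (by omega)).1 hik,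
    fun k j hkj hj => (hc k j hj).2 hkj, fun i j hji _ x hx hx' => ?_⟩
  refine hI {((i : ℤ), 0), ((j : ℤ), 1)} ⟨i, j, by omega, rfl⟩ fun s hs => ⟨x, fun p hp => ?_⟩
  rcases hs hp with rfl | rfl
  · exact hx
  · exact hx'

/-- `SOP_P` provides representations of all finite subsets of `P` in one model. -/
theorem FormulaHasSOPClass.exists_finite_representation {P : Type} [PartialOrder P] {m n : ℕ}
    {ψ : L.Formula (Fin m ⊕ Fin n)} (h : FormulaHasSOPClass T (age P) ψ) :
    ∃ M : Theory.ModelType.{u, v, max u v} T, ∀ S : Set P, S.Finite →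
      ∃ d : P → Fin n → M, ∀ s ∈ S, ∀ t ∈ S, Implies M ψ (d s) (d t) ↔ s ≤ t := by
  classical
  obtain ⟨M, hM⟩ := h
  refine ⟨M, fun S hS => ?_⟩
  have : Fintype S := hS.fintype
  obtain ⟨d, hd⟩ := hM (FinPartOrd.of S) ⟨OrderEmbedding.subtype (· ∈ S)⟩
  refine ⟨fun s => if hs : s ∈ S then d ⟨s, hs⟩ else fun _ => Classical.arbitrary M,
    fun s hs t ht => ?_⟩
  simp only [dif_pos hs, dif_pos ht]
  exact hd ⟨s, hs⟩ ⟨t, ht⟩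

/-- The formula `ψ(x; y) ∧ ¬ ψ(x; y')`. -/
def diffFormula {m n : ℕ} (ψ : L.Formula (Fin m ⊕ Fin n)) : L.Formula (Fin m ⊕ (Fin n ⊕ Fin n)) :=
  ψ.relabel (Sum.map id .inl) ⊓ (ψ.relabel (Sum.map id .inr)).not

theorem realize_diffFormula {m n : ℕ} (ψ : L.Formula (Fin m ⊕ Fin n)) {M : Type w} [L.Structure M]
    (x : Fin m → M) (y y' : Fin n → M) :
    (diffFormula ψ).Realize (Sum.elim x (Sum.elim y y')) ↔ Holds M ψ x y ∧ ¬ Holds M ψ x y' := by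
  simp only [diffFormula, Holds, Formula.realize_inf, Formula.realize_not,
    Formula.realize_relabel, Sum.elim_comp_map, Sum.elim_comp_inl, Sum.elim_comp_inr,
    Function.comp_id]

/-- The formula `ψ(x; β) ∧ ¬ ψ(x; γ)` has half graphs: a point of `α_C` outside `δ_C` satisfies
all instances with index in `C`, and `β_i ≤ γ_j` makes the instances at `i` and `j` disjoint. -/
theorem hasSOP3_of_hasSOPPoset (h : HasSOPPoset T sop3Pattern.Sig) : HasSOP3 T := by
  obtain ⟨m, n, ψ, h⟩ := h
  obtain ⟨M, hM⟩ := h.exists_finite_representation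
  refine hasSOP3_of_half_graphs M (diffFormula ψ) fun N => ?_
  let C (k : ℕ) : sop3Pattern.cons := ⟨_, sop3Cons_mem_cons k⟩
  let F : (Set.Iic N) × Fin 2 × Fin 4 → sop3Pattern.Sig := fun p =>
    ![.alpha (C p.1), .beta (p.1, p.2.1), .gamma (p.1, p.2.1), .delta (C p.1)] p.2.2
  obtain ⟨d, hd⟩ := hM (Set.range F) (Set.finite_range F)
  have hα (k : ℕ) (hk : k ≤ N) : .alpha (C k) ∈ Set.range F := ⟨(⟨k, hk⟩, 0, 0), rfl⟩
  have hβ (i : ℕ) (hi : i ≤ N) (e : Fin 2) : .beta ((i : ℤ), e) ∈ Set.range F :=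
    ⟨(⟨i, hi⟩, e, 1), rfl⟩
  have hγ (i : ℕ) (hi : i ≤ N) (e : Fin 2) : .gamma ((i : ℤ), e) ∈ Set.range F :=
    ⟨(⟨i, hi⟩, e, 2), rfl⟩
  have hδ (k : ℕ) (hk : k ≤ N) : .delta (C k) ∈ Set.range F := ⟨(⟨k, hk⟩, 0, 3), rfl⟩
  have hc : ∀ k : ℕ, ∃ c : Fin m → M, k ≤ N → Holds M ψ c (d (.alpha (C k))) ∧
      ¬ Holds M ψ c (d (.delta (C k))) := by
    intro k
    by_cases hk : k ≤ N
    · have := mt (hd _ (hα k hk) _ (hδ k hk)).1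
        (sop3Pattern_isMaximal.toIsConsistencyPattern.not_alpha_le_delta (C k))
      simp only [Implies, not_forall] at this
      obtain ⟨c, h₁, h₂⟩ := this
      exact ⟨c, fun _ => ⟨h₁, h₂⟩⟩
    · exact ⟨fun _ => Classical.arbitrary M, fun h => absurd h hk⟩
  choose c hc using hc
  have key (k : ℕ) (hk : k ≤ N) (i : ℕ) (hi : i ≤ N) (e : Fin 2) (hC : ((i : ℤ), e) ∈ (C k).1) :
      (diffFormula ψ).Realize (Sum.elim (c k) (Sum.elim (d (.beta (i, e))) (d (.gamma (i, e))))) :=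
    (realize_diffFormula ψ _ _ _).2
      ⟨(hd _ (hα k hk) _ (hβ i hi e)).2 (Pattern.Sig.alpha_le_beta hC) _ (hc k hk).1,
       fun hγc => (hc k hk).2
        ((hd _ (hγ i hi e) _ (hδ k hk)).2 (Pattern.Sig.gamma_le_delta hC) _ hγc)⟩
  refine ⟨fun i => Sum.elim (d (.beta (i, 0))) (d (.gamma (i, 0))),
    fun i => Sum.elim (d (.beta (i, 1))) (d (.gamma (i, 1))), c, fun i k hik hk => ?_,
    fun k j hkj hj => ?_, fun i j hji hi x hx hx' => ?_⟩
  · exact key k hk i (by omega) 0 (zero_mem_sop3Cons.2 (by omega))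
  · exact key k (by omega) j hj 1 (one_mem_sop3Cons.2 (by omega))
  · rw [realize_diffFormula] at hx hx'
    exact hx'.2 ((hd _ (hβ i hi 0) _ (hγ j (by omega) 1)).2 (Pattern.Sig.beta_le_gamma
      (pair_mem_inc.2 ⟨i, j, by omega, Or.inl ⟨rfl, rfl⟩⟩)) _ hx.1)

end HalfGraph

/-! ### From `SOP₃` to the tree property and to `SOP_Σ` -/

section Intervals

variable {L : FirstOrder.Language.{u, v}} {T : L.Theory}

/-- Along a densely ordered chain, a formula without directed cycles of length `3` defines the
order exactly: a reversed edge between `a p` and `a q` would close a cycle through a point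
strictly between them. -/
theorem HasSOP3.exists_dense_chain (h : HasSOP3 T) (I : Type) [LinearOrder I] [Countable I]
    [DenselyOrdered I] :
    ∃ (n : ℕ) (φ : L.Formula (Fin n ⊕ Fin n)) (M : Theory.ModelType.{u, v, max u v} T)
      (a : I → Fin n → M), (∀ p q, Holds M φ (a p) (a q) ↔ p < q) ∧
      ∀ x y z : Fin n → M, Holds M φ x y → Holds M φ y z → ¬ Holds M φ z x := by
  obtain ⟨n, φ, M, ⟨a, ha⟩, hM⟩ := h
  obtain ⟨N, ⟨b, hb⟩, hN⟩ := exists_chain_of_long_chains M φ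
    (fun _ => ⟨a, fun i j hij _ => ha i j hij⟩)
    (fun x y z h₁ h₂ h₃ => hM ⟨x, y, z, h₁, h₂, h₃⟩) I
  refine ⟨n, φ, N, b, fun p q => ⟨fun h => ?_, hb p q⟩, hN⟩
  by_contra hpq
  rcases (not_lt.1 hpq).eq_or_lt with rfl | hqp
  · exact hN _ _ _ h h h
  · obtain ⟨r, hqr, hrp⟩ := exists_between hqp
    exact hN _ _ _ (hb _ _ hqr) (hb _ _ hrp) h

/-- The order type of the chain. The layer with first coordinate `0` carries the pattern, the
layers `-1` and `1` bound it, and the points of the higher layers are outside all the intervals. -/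
abbrev Pos : Type := ℚ ×ₗ ℚ

instance : Countable Pos := inferInstanceAs (Countable (ℚ × ℚ))

/-- The left endpoint of the interval of an index. In the layer `0` the relevant endpoint of
`(i, 0)` is `3 * i + 1` and that of `(j, 1)` is `3 * j`, so that `j ≤ i` makes the intervals of
`(i, 0)` and `(j, 1)` disjoint, and `3 * k - 1` is free for the point realising `C_k`. -/
def lo (p : ℤ × Fin 2) : Pos := if p.2 = 0 then toLex (0, 3 * p.1 + 1) else toLex (-1, 0)

/-- The right endpoint of the interval of an index. -/
def hi (p : ℤ × Fin 2) : Pos := if p.2 = 0 then toLex (1, 0) else toLex (0, 3 * p.1)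

/-- A position in all intervals with index in `C_k` and in no others. -/
def mid (k : ℤ) : Pos := toLex (0, 3 * k - 1)

/-- A position reserved for an index, to the right of all intervals. -/
def own (p : ℤ × Fin 2) : Pos := toLex (2 + (p.2 : ℕ), p.1)

theorem hi_lt_lo {i j : ℤ} (h : j ≤ i) : hi (j, 1) < lo (i, 0) := by
  have : (j : ℚ) ≤ i := by exact_mod_cast h
  simp only [hi, lo, if_true, if_neg (show ¬ (1 : Fin 2) = 0 by decide), Prod.Lex.toLex_lt_toLex]
  right
  exact ⟨trivial, by linarith⟩

theorem mid_mem_iff (k : ℤ) (p : ℤ × Fin 2) : lo p < mid k ∧ mid k < hi p ↔ p ∈ sop3Cons k := by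
  obtain ⟨i, e⟩ := p
  fin_cases e
  · simp only [hi, lo, mid, Fin.zero_eta, if_true, Prod.Lex.toLex_lt_toLex, zero_mem_sop3Cons]
    norm_num
    constructor
    · intro h
      have : (3 * i + 1 : ℤ) < 3 * k - 1 := by exact_mod_cast h
      omega
    · intro h
      have : (3 * i + 1 : ℤ) < 3 * k - 1 := by omega
      exact_mod_cast this
  · simp only [hi, lo, mid, Fin.mk_one, if_neg (show ¬ (1 : Fin 2) = 0 by decide),
      Prod.Lex.toLex_lt_toLex, one_mem_sop3Cons]
    norm_num
    constructor
    · intro h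
      have : (3 * k : ℤ) < 3 * i + 1 := by exact_mod_cast (by linarith : (3 * k : ℚ) < 3 * i + 1)
      omega
    · intro h
      have : (k : ℚ) ≤ i := by exact_mod_cast h
      linarith

theorem hi_lt_of_one_lt (p : ℤ × Fin 2) {r s : ℚ} (h : 1 < r) : hi p < toLex (r, s) := by
  unfold hi
  split_ifs
  · exact Prod.Lex.toLex_lt_toLex.2 (Or.inl h)
  · exact Prod.Lex.toLex_lt_toLex.2 (Or.inl (by linarith))

theorem hi_lt_own (p q : ℤ × Fin 2) : hi p < own q :=
  hi_lt_of_one_lt p (by have : (0 : ℚ) ≤ ((q.2 : ℕ) : ℚ) := Nat.cast_nonneg _; linarith)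

theorem own_injective : Function.Injective own := by
  rintro ⟨i, e⟩ ⟨j, f⟩ h
  have h := Prod.ext_iff.1 (toLex.injective h)
  have h₁ : (e : ℕ) = f := by exact_mod_cast add_left_cancel h.1
  have h₂ : (i : ℚ) = j := h.2
  exact Prod.ext (by exact_mod_cast h₂) (Fin.ext h₁)

theorem mid_lt_own (k : ℤ) (p : ℤ × Fin 2) : mid k < own p :=
  Prod.Lex.toLex_lt_toLex.2 (Or.inl
    (by have : (0 : ℚ) ≤ ((p.2 : ℕ) : ℚ) := Nat.cast_nonneg _; simp only; linarith))

/-- The formula `φ(y; x) ∧ φ(x; z)` in the variables `(x; y, z)`. -/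
def betweenFormula {n : ℕ} (φ : L.Formula (Fin n ⊕ Fin n)) :
    L.Formula (Fin n ⊕ (Fin n ⊕ Fin n)) :=
  φ.relabel (Sum.elim (fun i => .inr (.inl i)) .inl) ⊓ φ.relabel (Sum.map id .inr)

theorem realize_betweenFormula {n : ℕ} (φ : L.Formula (Fin n ⊕ Fin n)) {M : Type w} [L.Structure M]
    (x y z : Fin n → M) : (betweenFormula φ).Realize (Sum.elim x (Sum.elim y z)) ↔
      Holds M φ y x ∧ Holds M φ x z := by
  simp only [betweenFormula, Formula.realize_inf, Formula.realize_relabel, Sum.comp_elim, Holds,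
    Sum.elim_comp_map, Sum.elim_comp_inr, Function.comp_id]
  rfl

/-- The index `(i, 0)` is sent to the formula `φ(aᵢ; x)`, and `(j, 1)` to `φ(x; a'ⱼ)`, for elements
of a chain with `a'ⱼ` before `aᵢ` if and only if `j ≤ i`; each is completed to an interval, so that
both come from the same formula. -/
theorem hasTreeProperty_of_hasSOP3 (h : HasSOP3 T) : HasTreeProperty T sop3Pattern := by
  obtain ⟨n, φ, M, a, ha, hM⟩ := h.exists_dense_chain Pos
  refine ⟨_, _, reindex (betweenFormula φ), M, fun p =>
    Sum.elim (a (lo p)) (a (hi p)) ∘ (Finite.equivFin _).symm, ?_, ?_⟩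
  · rintro _ ⟨k, rfl⟩ s hs
    refine ⟨a (mid k) ∘ (Finite.equivFin _).symm, fun p hp => ?_⟩
    rw [holds_reindex_comp, realize_betweenFormula, ha, ha]
    exact (mid_mem_iff k p).2 (hs hp)
  · rintro _ ⟨i, j, hij, rfl⟩ hcons
    obtain ⟨x, hx⟩ := hcons {(i, 0), (j, 1)} (by simp)
    have h₀ := hx (i, 0) (by simp)
    have h₁ := hx (j, 1) (by simp)
    simp only [holds_reindex, Function.comp_assoc, Equiv.symm_comp_self, Function.comp_id,
      realize_betweenFormula] at h₀ h₁
    exact hM _ _ _ h₀.1 h₁.2 ((ha _ _).2 (hi_lt_lo hij))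

/-- Equality of two tuples of variables. -/
noncomputable def tupleEq {n : ℕ} {α : Type} (f g : Fin n → α) : L.Formula α :=
  Formula.iInf fun i => Term.equal (Term.var (f i)) (Term.var (g i))

theorem realize_tupleEq {n : ℕ} {α : Type} (f g : Fin n → α) {M : Type w} [L.Structure M]
    (x : α → M) : (tupleEq f g : L.Formula α).Realize x ↔ x ∘ f = x ∘ g := by
  simp [tupleEq, Formula.realize_iInf, funext_iff]

/-- The formula `((φ(y; x) ∧ φ(x; z)) ∨ x = w) ↔ t = w` in the variables `(x; y, z, w, t)`.
Its instances are the sets "interval from `y` to `z`, with the extra point `w`" if `t = w`, and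
their complements if `t ≠ w`. -/
noncomputable def sigFormula {n : ℕ} (φ : L.Formula (Fin n ⊕ Fin n)) :
    L.Formula (Fin n ⊕ ((Fin n ⊕ Fin n) ⊕ (Fin n ⊕ Fin n))) :=
  ((betweenFormula φ).relabel (Sum.map id .inl) ⊔
    tupleEq .inl (fun i => .inr (.inr (.inl i)))).iff
  (tupleEq (fun i => .inr (.inr (.inr i))) (fun i => .inr (.inr (.inl i))))

theorem realize_sigFormula {n : ℕ} (φ : L.Formula (Fin n ⊕ Fin n)) {M : Type w} [L.Structure M]
    (x y z w t : Fin n → M) :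
    (sigFormula φ).Realize (Sum.elim x (Sum.elim (Sum.elim y z) (Sum.elim w t))) ↔
      ((Holds M φ y x ∧ Holds M φ x z ∨ x = w) ↔ t = w) := by
  simp only [sigFormula, Formula.realize_iff, Formula.realize_sup, Formula.realize_relabel,
    realize_tupleEq, Sum.elim_comp_map, Function.comp_id, Sum.elim_comp_inl, realize_betweenFormula]
  rfl

/-- The representation of `P.Sig` by sets, with `B p` the interval of the index `p` together with
a point of its own. -/
theorem hasSOPPoset_of_hasSOP3 (h : HasSOP3 T) : HasSOPPoset T sop3Pattern.Sig := by
  obtain ⟨n, φ, M, a, ha, hM⟩ := h.exists_dense_chain Pos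
  have hinj : Function.Injective a := fun p q hpq => by
    by_contra hne
    rcases lt_or_gt_of_ne hne with h | h
    · exact lt_irrefl q ((ha q q).1 (hpq ▸ (ha p q).2 h))
    · exact lt_irrefl q ((ha q q).1 (hpq ▸ (ha q p).2 h))
  choose k hk using fun C : sop3Pattern.cons => C.2
  let far : Pos := toLex (4, 0)
  let B (p : ℤ × Fin 2) : Set (Fin n → M) :=
    {x | Holds M φ (a (lo p)) x ∧ Holds M φ x (a (hi p)) ∨ x = a (own p)}
  let c (C : sop3Pattern.cons) : Fin n → M := a (mid (k C))
  have hB (r : Pos) (p : ℤ × Fin 2) : a r ∈ B p ↔ lo p < r ∧ r < hi p ∨ r = own p := by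
    simp only [B, Set.mem_ofPred_eq, ha, hinj.eq_iff]
  have hown_far (p : ℤ × Fin 2) : own p < far := by
    refine Prod.Lex.toLex_lt_toLex.2 (Or.inl ?_)
    have : ((p.2 : ℕ) : ℚ) < 2 := by exact_mod_cast p.2.isLt
    simp only
    linarith
  have hdisj : ∀ i j : ℤ, j ≤ i → Disjoint (B (i, 0)) (B (j, 1)) := by
    intro i j hij
    rw [Set.disjoint_left]
    rintro x (hx | rfl) hx'
    · rcases hx' with hx' | rfl
      · exact hM _ _ _ hx.1 hx'.2 ((ha _ _).2 (hi_lt_lo hij))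
      · exact lt_asymm ((ha _ _).1 hx.2) (hi_lt_own _ _)
    · rcases (hB _ _).1 hx' with hx' | hx'
      · exact lt_asymm hx'.2 (hi_lt_own _ _)
      · exact absurd (Prod.ext_iff.1 (own_injective hx')).2 Fin.zero_ne_one
  have hrep := sop3Pattern_isMaximal.toSet_subset_iff (B := B) (c := c) (p := fun p => a (own p))
    (q := a far)
    (fun C p => by
      rw [hB, or_iff_left (mid_lt_own _ _).ne, mid_mem_iff, ← hk])
    (fun p q h => by
      obtain ⟨i, j, hij, ⟨rfl, rfl⟩ | ⟨rfl, rfl⟩⟩ := pair_mem_inc.1 h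
      · exact hdisj i j hij
      · exact (hdisj i j hij).symm)
    (fun p q => by
      rw [hB, or_iff_right fun h => lt_asymm h.2 (hi_lt_own _ _), own_injective.eq_iff])
    (fun p C => hinj.ne (mid_lt_own _ _).ne')
    (fun p => by
      rw [hB]
      rintro (h | h)
      · exact lt_asymm h.2 ((hi_lt_own p p).trans (hown_far p))
      · exact (hown_far p).ne' h)
    (fun C => hinj.ne ((mid_lt_own (k C) (0, 0)).trans (hown_far _)).ne')
  -- the interval from `far` to `lo (0, 0)` is empty, as its endpoints are in the wrong order
  let d : sop3Pattern.Sig → (Fin n ⊕ Fin n) ⊕ (Fin n ⊕ Fin n) → M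
    | .alpha C => Sum.elim (Sum.elim (a far) (a (lo (0, 0)))) (Sum.elim (c C) (c C))
    | .beta p => Sum.elim (Sum.elim (a (lo p)) (a (hi p))) (Sum.elim (a (own p)) (a (own p)))
    | .gamma p => Sum.elim (Sum.elim (a (lo p)) (a (hi p))) (Sum.elim (a (own p)) (a far))
    | .delta C => Sum.elim (Sum.elim (a far) (a (lo (0, 0)))) (Sum.elim (c C) (a far))
  have hlo_far : lo (0, 0) < far := Prod.Lex.toLex_lt_toLex.2 (Or.inl (by norm_num))
  have hempty (x : Fin n → M) : ¬ (Holds M φ (a far) x ∧ Holds M φ x (a (lo (0, 0)))) :=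
    fun h => hM _ _ _ h.1 h.2 ((ha _ _).2 hlo_far)
  have hd (s : sop3Pattern.Sig) (x : Fin n → M) :
      (sigFormula φ).Realize (Sum.elim x (d s)) ↔ x ∈ Pattern.Sig.toSet B c s := by
    cases s with
    | alpha C => simp [d, realize_sigFormula, hempty, Pattern.Sig.toSet]
    | beta p => simp [d, realize_sigFormula, Pattern.Sig.toSet, B]
    | gamma p =>
      have : a far ≠ a (own p) := hinj.ne (hown_far p).ne'
      simp only [d, realize_sigFormula, this, iff_false]
      rfl
    | delta C =>
      have : a far ≠ c C := hinj.ne ((mid_lt_own (k C) (0, 0)).trans (hown_far _)).ne'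
      simp [d, realize_sigFormula, hempty, Pattern.Sig.toSet, this]
  refine ⟨_, _, reindex (sigFormula φ), M, ?_⟩
  rintro σ ⟨f⟩
  refine ⟨fun s => d (f s) ∘ (Finite.equivFin _).symm, fun s t => ?_⟩
  rw [← f.le_iff_le, ← hrep]
  constructor
  · intro h x hx
    have := h (x ∘ (Finite.equivFin _).symm)
    simp only [holds_reindex_comp, hd] at this
    exact this hx
  · intro h x hx
    simp only [holds_reindex, Function.comp_assoc, Equiv.symm_comp_self, Function.comp_id, hd]
      at hx ⊢
    exact h hx

end Intervals

end DividingLines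

theorem mainTheorem6 :
    DividingLines.sop3Pattern.IsMaximal ∧
    ∀ (L : FirstOrder.Language.{u, v}) (T : L.Theory), T.IsComplete →
      (DividingLines.HasSOP3 T ↔
        DividingLines.HasTreeProperty T DividingLines.sop3Pattern) ∧
      (DividingLines.HasSOP3 T ↔
        DividingLines.HasSOPPoset T DividingLines.sop3Pattern.Sig) :=
  ⟨DividingLines.sop3Pattern_isMaximal, fun _ _ _ =>
    ⟨⟨DividingLines.hasTreeProperty_of_hasSOP3, DividingLines.hasSOP3_of_hasTreeProperty⟩,
      ⟨DividingLines.hasSOPPoset_of_hasSOP3, DividingLines.hasSOP3_of_hasSOPPoset⟩⟩⟩
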